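/- Fix $T>0$ and integers $Q\ge 2$, $n\ge 3$. In the undirected affiliation Poisson process stochastic block model with $n$ individuals and $Q$ groups on $[0,T]$, the parameter is $\theta=(\pi,\alpha^{\mathrm{in}},\alpha^{\mathrm{out}})$, where $\pi_1,\dots,\pi_Q>0$, $\sum_{q=1}^Q\pi_q=1$, and $\alpha^{\mathrm{in}},\alpha^{\mathrm{out}}$ are nonnegative integrable functions on $[0,T]$. The latent groups $Z_1,\dots,Z_n$ are independent with $\mathrm{pr}(Z_i=q)=\pi_q$ $(q=1,\dots,Q)$; conditionally on $Z_1,\dots,Z_n$, the counting processes $N_{i,j}$ $(1\le i<j\le n)$ are independent inhomogeneous Poisson processes on $[0,T]$, and $N_{i,j}$ has intensity $\alpha^{\mathrm{in}}$ if $Z_i=Z_j$ and $\alpha^{\mathrm{out}}$ if $Z_i\ne Z_j$. Let $\mathrm{pr}_\theta$ be the (unconditional) distribution of $(N_{i,j})_{1\le i<j\le n}$. Let $\theta=(\pi,\alpha^{\mathrm{in}},\alpha^{\mathrm{out}})$ be such a parameter for which $\alpha^{\mathrm{in}}$ and $\alpha^{\mathrm{out}}$ are distinct, i.e. not equal almost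 everywhere on $[0,T]$, and let $\tilde\theta=(\tilde\pi,\tilde\alpha^{\mathrm{in}},\tilde\alpha^{\mathrm{out}})$ be any such parameter (with the same $n$, $Q$, $T$) with $\mathrm{pr}_\theta=\mathrm{pr}_{\tilde\theta}$. Then $\alpha^{\mathrm{in}}=\tilde\alpha^{\mathrm{in}}$ and $\alpha^{\mathrm{out}}=\tilde\alpha^{\mathrm{out}}$ almost everywhere on $[0,T]$. If moreover $n\ge Q$ (that is, $n\ge\max\{Q,3\}$), then there is a permutation $\sigma$ of $\{1,\dots,Q\}$ such that $\pi_q=\tilde\pi_{\sigma(q)}$ for all $q=1,\dots,Q$. -/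

import Mathlib

open MeasureTheory Set

noncomputable section

namespace PPSBM

/-- Unordered pairs of distinct individuals, each written once as `(i, j)` with `i < j`
(undirected dyads without self-interactions). -/
abbrev Dyad (n : ℕ) : Type := {p : Fin n × Fin n // p.1 < p.2}

/-- Trajectories `t ↦ N(t)` of a counting process on `[0,T]`, with the product σ-algebra, that is
the one generated by the evaluations `N ↦ N(t)`. -/
abbrev Path (T : ℝ) : Type := Icc (0 : ℝ) T → ℕ

/-- The measure `A(I) = ∫_I a(u) du` on `[0,T]` with intensity `a`. -/
def intensityMeasure (T : ℝ) (a : ℝ → ℝ) : Measure ℝ :=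
  (volume.restrict (Icc (0 : ℝ) T)).withDensity fun t => ENNReal.ofReal (a t)

/-- The counting function `t ↦ #{i : x_i ≤ t}` of the event times `x_1, …, x_k`. -/
def countingPath (T : ℝ) {k : ℕ} (x : Fin k → ℝ) : Path T :=
  fun t => (Finset.univ.filter fun i => x i ≤ (t : ℝ)).card

theorem measurable_countingPath (T : ℝ) (k : ℕ) :
    Measurable (countingPath T : (Fin k → ℝ) → Path T) := by
  refine measurable_pi_iff.2 fun t => ?_
  have h : (fun x : Fin k → ℝ => countingPath T x t)
      = fun x => ∑ i, if x i ≤ (t : ℝ) then 1 else 0 := by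
    funext x
    simp [countingPath]
  rw [h]
  refine Finset.measurable_sum _ fun i _ => ?_
  exact Measurable.ite (measurableSet_le (measurable_pi_apply i) measurable_const)
    measurable_const measurable_const

/-- The law of the inhomogeneous Poisson process on `[0,T]` with (integrable) intensity `a`.
With `A` the measure of intensity `a` and `m = A([0,T])`, the number of events is Poisson with
mean `m` and, given that it equals `k`, the events are `k` independent points of law `A / m`.
The factor `m ^ k` of the Poisson weight `exp (-m) * m ^ k / k!` cancels the normalisation of the
`k`-fold product of `A / m`. -/
def poissonProcessLaw (T : ℝ) (a : ℝ → ℝ) : Measure (Path T) :=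
  Measure.sum fun k : ℕ =>
    (ENNReal.ofReal (Real.exp (-(intensityMeasure T a).real univ)) / (Nat.factorial k : ENNReal)) •
      (Measure.pi fun _ : Fin k => intensityMeasure T a).map (countingPath T)

/-- The conditional law of the processes `(N_{i,j})_{i<j}` given the groups `Z = z`: independent
Poisson processes, `N_{i,j}` having intensity `α^{(z_i,z_j)}`. -/
def conditionalLaw {n Q : ℕ} (T : ℝ) (α : Fin Q → Fin Q → ℝ → ℝ) (z : Fin n → Fin Q) :
    Measure (Dyad n → Path T) :=
  Measure.pi fun e : Dyad n => poissonProcessLaw T (α (z e.1.1) (z e.1.2))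

/-- The law of the multivariate counting process `(N_{i,j})_{i<j}` in the undirected Poisson process
stochastic block model with proportions `π` and (symmetric) intensities `α`: the latent groups
`Z_1, …, Z_n` are independent of law `π`, and are integrated out. -/
def sbmLaw {Q : ℕ} (n : ℕ) (T : ℝ) (π : Fin Q → ℝ) (α : Fin Q → Fin Q → ℝ → ℝ) :
    Measure (Dyad n → Path T) :=
  ∑ z : Fin n → Fin Q, ENNReal.ofReal (∏ i, π (z i)) • conditionalLaw T α z

/-- Parameters of the affiliation model with `Q` groups on `[0,T]`: non-zero proportions and two
intensities, which are nonnegative and integrable on `[0,T]`. -/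
structure AffiliationParam (Q : ℕ) (T : ℝ) where
  /-- the group proportions `π_1, …, π_Q` -/
  prop : Fin Q → ℝ
  /-- the intensity within groups -/
  αin : ℝ → ℝ
  /-- the intensity between groups -/
  αout : ℝ → ℝ
  prop_pos : ∀ q, 0 < prop q
  sum_prop : ∑ q, prop q = 1
  αin_nonneg : ∀ t ∈ Icc (0 : ℝ) T, 0 ≤ αin t
  αout_nonneg : ∀ t ∈ Icc (0 : ℝ) T, 0 ≤ αout t
  αin_integrable : IntegrableOn αin (Icc (0 : ℝ) T)
  αout_integrable : IntegrableOn αout (Icc (0 : ℝ) T)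

namespace AffiliationParam

variable {Q : ℕ} {T : ℝ}

/-- `α^{(q,q)} = αin` and `α^{(q,l)} = αout` for `q ≠ l`. -/
def intensity (θ : AffiliationParam Q T) (q l : Fin Q) : ℝ → ℝ :=
  if q = l then θ.αin else θ.αout

/-- The law `pr_θ` of the affiliation model with `n` individuals. -/
def law (θ : AffiliationParam Q T) (n : ℕ) : Measure (Dyad n → Path T) :=
  sbmLaw n T θ.prop θ.intensity

end AffiliationParam

end PPSBM

end

/-! Let `D f = meanIn f - meanOut f` for a bounded test function `f` of a trajectory, and `p_k` the
`k`-th power sum of the proportions. On a triangle of individuals, the third joint cumulant of tests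
`f`, `g`, `h` on the three edges is `κ * D f * D g * D h` with `κ = p_3 - 3 p_2 p_3 + 2 p_2 ^ 3`,
positive by `triangle_cumulant_pos`. Equal laws therefore give `D' = c D` with `c > 0`. Together
with the mean of one edge, this makes each Poisson mean under `θ'` an affine combination of the two
under `θ`. Generating functions at `1/2` and `0` force its coefficient to be 0 or 1
(`affine_exp_eq_zero_or_one`), and `c > 0` excludes a swap or a collapse. Once the intensities are
known, a test centred to have `meanOut` zero, placed on all dyads within `k` individuals, reads off
`p_k` for `k ≤ n`. Newton's identities then recover the proportions. -/

namespace PPSBM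

/-! ### Intensities and their cumulative measures -/

theorem isFiniteMeasure_intensityMeasure {T : ℝ} {a : ℝ → ℝ} (ha : IntegrableOn a (Icc (0 : ℝ) T)) :
    IsFiniteMeasure (intensityMeasure T a) :=
  isFiniteMeasure_withDensity_ofReal ha.2

/-- Equality of the cumulative intensities forces equality of the intensities. -/
theorem ae_eq_of_intensityMeasure_Iic_eq {T : ℝ} (hT : 0 < T) {a b : ℝ → ℝ}
    (ha : IntegrableOn a (Icc (0 : ℝ) T)) (hb : IntegrableOn b (Icc (0 : ℝ) T))
    (ha0 : ∀ t ∈ Icc (0 : ℝ) T, 0 ≤ a t) (hb0 : ∀ t ∈ Icc (0 : ℝ) T, 0 ≤ b t)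
    (h : ∀ t ∈ Icc (0 : ℝ) T,
      (intensityMeasure T a).real (Iic t) = (intensityMeasure T b).real (Iic t)) :
    a =ᵐ[volume.restrict (Icc (0 : ℝ) T)] b := by
  have := isFiniteMeasure_intensityMeasure ha
  have := isFiniteMeasure_intensityMeasure hb
  have key : intensityMeasure T a = intensityMeasure T b := by
    -- The measures are carried by `[0,T]`, so half-lines with endpoint outside `[0,T]` reduce to
    -- those covered by `h` or are null.
    have hclip : ∀ (c : ℝ → ℝ) (t : ℝ), 0 ≤ t →
        intensityMeasure T c (Iic t) = intensityMeasure T c (Iic (min t T)) := by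
      intro c t ht
      simp only [intensityMeasure]
      rw [withDensity_apply _ measurableSet_Iic, withDensity_apply _ measurableSet_Iic,
        Measure.restrict_restrict measurableSet_Iic, Measure.restrict_restrict measurableSet_Iic]
      congr 2
      ext x
      simp only [mem_inter_iff, mem_Iic, mem_Icc, le_min_iff]
      tauto
    have hneg : ∀ (c : ℝ → ℝ) (t : ℝ), t < 0 → intensityMeasure T c (Iic t) = 0 := by
      intro c t ht
      simp only [intensityMeasure]
      rw [withDensity_apply _ measurableSet_Iic, Measure.restrict_restrict measurableSet_Iic]
      have : Iic t ∩ Icc 0 T = ∅ := by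
        ext x
        simp only [mem_inter_iff, mem_Iic, mem_Icc, mem_empty_iff_false, iff_false]
        intro hx
        linarith [hx.1, hx.2.1]
      simp [this]
    refine Measure.ext_of_Iic _ _ fun t => ?_
    rcases lt_or_ge t 0 with ht | ht
    · rw [hneg a t ht, hneg b t ht]
    · rw [hclip a t ht, hclip b t ht]
      have := h (min t T) ⟨le_min ht hT.le, min_le_right _ _⟩
      rwa [measureReal_def, measureReal_def, ENNReal.toReal_eq_toReal_iff' (by finiteness)
        (by finiteness)] at this
  have hae := (withDensity_eq_iff ha.1.aemeasurable.ennreal_ofReal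
    hb.1.aemeasurable.ennreal_ofReal (by
      have : ∫⁻ t in Icc (0 : ℝ) T, ENNReal.ofReal (a t) = intensityMeasure T a univ := by
        simp [intensityMeasure]
      rw [this]
      finiteness)).1 key
  filter_upwards [hae, ae_restrict_mem measurableSet_Icc] with t ht htm
  exact (ENNReal.ofReal_eq_ofReal_iff (ha0 t htm) (hb0 t htm)).1 ht

/-! ### Generating functions of Poisson processes -/

/-- The function `N ↦ c ^ N(t)`, whose mean is the probability generating function of `N(t)`. -/
noncomputable def pathPow {T : ℝ} (t : Icc (0 : ℝ) T) (c : ℝ) (N : Path T) : ℝ := c ^ N t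

theorem measurable_pathPow {T : ℝ} (t : Icc (0 : ℝ) T) (c : ℝ) : Measurable (pathPow t c) :=
  (measurable_from_top (f := fun k : ℕ => c ^ k)).comp (measurable_pi_apply t)

/-- Each point contributes a factor `1 + (c - 1) 1{x_i ≤ t}`, so Fubini yields a `k`-th power. -/
theorem integral_pow_countingPath {T : ℝ} (μ : Measure ℝ) [IsFiniteMeasure μ] (t : Icc (0 : ℝ) T)
    (c : ℝ) (k : ℕ) :
    Integrable (fun x : Fin k → ℝ => pathPow t c (countingPath T x)) (Measure.pi fun _ => μ) ∧
    ∫ x : Fin k → ℝ, pathPow t c (countingPath T x) ∂(Measure.pi fun _ => μ)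
      = (μ.real univ - (1 - c) * μ.real (Iic (t : ℝ))) ^ k := by
  have hg : ∀ x : Fin k → ℝ, pathPow t c (countingPath T x)
      = ∏ i, ((Iic (t : ℝ)).indicator (fun _ => c - 1) (x i) + 1) := by
    intro x
    simp only [pathPow, countingPath, indicator_apply, mem_Iic]
    rw [← Finset.prod_const, Finset.prod_filter]
    refine Finset.prod_congr rfl fun i _ => ?_
    split_ifs <;> ring
  have hi : Integrable ((Iic (t : ℝ)).indicator (fun _ => c - 1)) μ :=
    (integrable_const _).indicator measurableSet_Iic
  simp_rw [hg]
  refine ⟨Integrable.fintype_prod (f := fun _ y => (Iic (t : ℝ)).indicator (fun _ => c - 1) y + 1)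
    fun _ => hi.add (integrable_const _), ?_⟩
  rw [integral_fintype_prod_eq_pow (fun y => (Iic (t : ℝ)).indicator (fun _ => c - 1) y + 1),
    integral_add hi (integrable_const _), integral_indicator measurableSet_Iic]
  simp
  ring

/-- Summing over the number of points gives the exponential series of `y`. The case `c = 1` is the
total mass, so no finiteness of the law is presupposed. -/
theorem lintegral_pathPow {T : ℝ} {a : ℝ → ℝ} (ha : IntegrableOn a (Icc (0 : ℝ) T))
    (t : Icc (0 : ℝ) T) {c : ℝ} (h0 : 0 ≤ c) :
    ∫⁻ N, ENNReal.ofReal (pathPow t c N) ∂(poissonProcessLaw T a)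
      = ENNReal.ofReal (Real.exp (-((1 - c) * (intensityMeasure T a).real (Iic (t : ℝ))))) := by
  have := isFiniteMeasure_intensityMeasure ha
  set μ := intensityMeasure T a with hμ
  set m := μ.real univ with hm
  set y := m - (1 - c) * μ.real (Iic (t : ℝ)) with hy
  have hle : μ.real (Iic (t : ℝ)) ≤ m := measureReal_mono (subset_univ _)
  have hy0 : 0 ≤ y := by
    have : 0 ≤ μ.real (Iic (t : ℝ)) := measureReal_nonneg
    nlinarith [mul_nonneg h0 this]
  have hterm : ∀ k : ℕ, ∫⁻ N, ENNReal.ofReal (pathPow t c N)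
      ∂((ENNReal.ofReal (Real.exp (-m)) / (Nat.factorial k : ENNReal)) •
        (Measure.pi fun _ : Fin k => μ).map (countingPath T))
      = ENNReal.ofReal (Real.exp (-m) * (y ^ k / (Nat.factorial k : ℝ))) := by
    intro k
    obtain ⟨hi, he⟩ := integral_pow_countingPath μ t c k
    rw [lintegral_smul_measure, lintegral_map (measurable_pathPow t c).ennreal_ofReal
      (measurable_countingPath T k), ← ofReal_integral_eq_lintegral_ofReal hi
      (Filter.Eventually.of_forall fun x => pow_nonneg h0 _), he, smul_eq_mul,
      ← ENNReal.ofReal_natCast, ← ENNReal.ofReal_div_of_pos (by positivity),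
      ← ENNReal.ofReal_mul (by positivity)]
    congr 1
    ring
  have hs : HasSum (fun k : ℕ => Real.exp (-m) * (y ^ k / (Nat.factorial k : ℝ)))
      (Real.exp (-m) * Real.exp y) := by
    rw [Real.exp_eq_exp_ℝ]
    exact (NormedSpace.expSeries_div_hasSum_exp y).mul_left _
  rw [poissonProcessLaw, lintegral_sum_measure]
  simp_rw [← hμ, ← hm, hterm]
  rw [← ENNReal.ofReal_tsum_of_nonneg (fun k => by positivity) hs.summable, hs.tsum_eq,
    ← Real.exp_add]
  congr 2
  rw [hy]
  ring

theorem isProbabilityMeasure_poissonProcessLaw {T : ℝ} (hT : 0 < T) {a : ℝ → ℝ}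
    (ha : IntegrableOn a (Icc (0 : ℝ) T)) : IsProbabilityMeasure (poissonProcessLaw T a) := by
  have h := lintegral_pathPow ha ⟨0, left_mem_Icc.2 hT.le⟩ zero_le_one
  constructor
  simpa [pathPow] using h

theorem integral_pathPow {T : ℝ} {a : ℝ → ℝ} (ha : IntegrableOn a (Icc (0 : ℝ) T))
    (t : Icc (0 : ℝ) T) {c : ℝ} (h0 : 0 ≤ c) :
    ∫ N, pathPow t c N ∂(poissonProcessLaw T a)
      = Real.exp (-((1 - c) * (intensityMeasure T a).real (Iic (t : ℝ)))) := by
  rw [integral_eq_lintegral_of_nonneg_ae (f := pathPow t c)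
    (Filter.Eventually.of_forall fun N => pow_nonneg h0 _)
    (measurable_pathPow t c).aestronglyMeasurable, lintegral_pathPow ha t h0,
    ENNReal.toReal_ofReal (Real.exp_pos _).le]

end PPSBM

/-! ### Power sums of the proportions -/

/-- The probability that all individuals in `S` belong to the same group is a power sum. -/
theorem sum_prod_ite_const_on_eq_sum_pow {n Q : ℕ} (p : Fin Q → ℝ) (hp : ∑ q, p q = 1)
    (S : Finset (Fin n)) (hS : S.Nonempty) :
    ∑ z : Fin n → Fin Q, (∏ i, p (z i)) * (if ∀ i ∈ S, ∀ j ∈ S, z i = z j then 1 else 0)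
      = ∑ q, p q ^ S.card := by
  classical
  -- As `S` is nonempty, the indicator is a sum over the common group `q`; each summand is a product
  -- over individuals, so the sum over `z` factorises.
  have hind : ∀ z : Fin n → Fin Q, (if ∀ i ∈ S, ∀ j ∈ S, z i = z j then (1 : ℝ) else 0)
      = ∑ q, ∏ i, (if i ∈ S then (if z i = q then 1 else 0) else 1) := by
    intro z
    obtain ⟨i₀, hi₀⟩ := hS
    have hprod : ∀ q, ∏ i, (if i ∈ S then (if z i = q then (1 : ℝ) else 0) else 1)
        = if ∀ i ∈ S, z i = q then 1 else 0 := by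
      intro q
      rw [Finset.prod_ite_mem, Finset.univ_inter, Finset.prod_ite_zero]
      simp
    simp_rw [hprod]
    rw [Finset.sum_eq_single (z i₀)]
    · congr 1
      exact propext ⟨fun h i hi => h i hi i₀ hi₀, fun h i hi j hj => (h i hi).trans (h j hj).symm⟩
    · intro q _ hq
      exact if_neg fun h => hq (h i₀ hi₀).symm
    · simp
  simp_rw [hind, Finset.mul_sum]
  rw [Finset.sum_comm]
  refine Finset.sum_congr rfl fun q _ => ?_
  simp_rw [← Finset.prod_mul_distrib]
  have := Finset.prod_univ_sum (fun _ : Fin n => (Finset.univ : Finset (Fin Q)))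
    (fun i x => p x * (if i ∈ S then (if x = q then 1 else 0) else 1))
  rw [Fintype.piFinset_univ] at this
  rw [← this]
  have hf : ∀ i : Fin n, ∑ x, p x * (if i ∈ S then (if x = q then 1 else 0) else 1)
      = if i ∈ S then p q else 1 := by
    intro i
    split_ifs <;> simp [hp]
  simp_rw [hf]
  rw [Finset.prod_ite_mem, Finset.univ_inter, Finset.prod_const]

/-- Two families of reals with the same power sums agree up to a permutation. -/
theorem exists_perm_of_sum_pow_eq {Q : ℕ} (p r : Fin Q → ℝ)
    (h : ∀ k, 1 ≤ k → k ≤ Q → ∑ q, p q ^ k = ∑ q, r q ^ k) :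
    ∃ σ : Equiv.Perm (Fin Q), ∀ q, p q = r (σ q) := by
  classical
  have hes : ∀ k ≤ Q, MvPolynomial.aeval p (MvPolynomial.esymm (Fin Q) ℝ k)
      = MvPolynomial.aeval r (MvPolynomial.esymm (Fin Q) ℝ k) := by
    intro k
    induction k using Nat.strong_induction_on with
    | _ k ih =>
      intro hk
      rcases Nat.eq_zero_or_pos k with rfl | hk0
      · simp
      have hn := MvPolynomial.mul_esymm_eq_sum (Fin Q) ℝ k
      have h1 := congrArg (MvPolynomial.aeval p) hn
      have h2 := congrArg (MvPolynomial.aeval r) hn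
      simp only [map_mul, map_natCast, map_pow, map_neg, map_one, map_sum] at h1 h2
      have hk' : (k : ℝ) ≠ 0 := by positivity
      refine mul_left_cancel₀ hk' ?_
      rw [h1, h2]
      congr 1
      refine Finset.sum_congr rfl fun x hx => ?_
      rw [Finset.mem_filter] at hx
      have hadd := Finset.HasAntidiagonal.mem_antidiagonal.1 hx.1
      rw [ih x.1 hx.2 (by omega)]
      congr 1
      simpa [MvPolynomial.psum] using h x.2 (by omega) (by omega)
  -- Equal elementary symmetric functions give the same monic polynomial, hence the same multiset of
  -- roots.
  have hm : Finset.univ.val.map p = Finset.univ.val.map r := by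
    have hX : ((Finset.univ.val.map p).map fun t => Polynomial.X - Polynomial.C t).prod
        = ((Finset.univ.val.map r).map fun t => Polynomial.X - Polynomial.C t).prod := by
      rw [Multiset.prod_X_sub_X_eq_sum_esymm, Multiset.prod_X_sub_X_eq_sum_esymm]
      simp only [Multiset.card_map, Finset.card_val, Finset.card_univ, Fintype.card_fin]
      refine Finset.sum_congr rfl fun k hk => ?_
      rw [← MvPolynomial.aeval_esymm_eq_multiset_esymm (Fin Q) ℝ,
        ← MvPolynomial.aeval_esymm_eq_multiset_esymm (Fin Q) ℝ,
        hes k (by simpa [Nat.lt_succ_iff] using hk)]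
    have := congrArg Polynomial.roots hX
    rwa [Polynomial.roots_multiset_prod_X_sub_C, Polynomial.roots_multiset_prod_X_sub_C] at this
  have hcard : ∀ x, (Finset.univ.filter fun q => p q = x).card
      = (Finset.univ.filter fun q => r q = x).card := by
    intro x
    have := congrArg (Multiset.count x) hm
    rw [Multiset.count_map, Multiset.count_map] at this
    simpa [Finset.card, Finset.filter, eq_comm] using this
  have e : ∀ x, Nonempty ({q // p q = x} ≃ {q // r q = x}) := fun x =>
    Fintype.card_eq.1 (by simpa [Fintype.card_subtype] using hcard x)
  refine ⟨Equiv.ofFiberEquiv fun x => (e x).some, fun q => (Equiv.ofFiberEquiv_map _ q).symm⟩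

/-- Positivity of the coefficient of the third joint cumulant of the edges of a triangle. -/
theorem triangle_cumulant_pos {Q : ℕ} (hQ : 2 ≤ Q) (p : Fin Q → ℝ) (h0 : ∀ q, 0 < p q)
    (h1 : ∑ q, p q = 1) :
    0 < ∑ q, p q ^ 3 - 3 * (∑ q, p q ^ 2) * (∑ q, p q ^ 3) + 2 * (∑ q, p q ^ 2) ^ 3 := by
  set s := ∑ q, p q ^ 2 with hs
  set u := ∑ q, p q ^ 3 with hu
  have hlt : ∀ q, p q < 1 := by
    intro q
    have : Nontrivial (Fin Q) := Fin.nontrivial_iff_two_le.2 hQ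
    obtain ⟨r, hr⟩ := exists_ne q
    rw [← h1]
    exact Finset.single_lt_sum hr (Finset.mem_univ q) (Finset.mem_univ r) (h0 r)
      fun k _ _ => (h0 k).le
  have hne : (Finset.univ : Finset (Fin Q)).Nonempty := ⟨⟨0, by omega⟩, Finset.mem_univ _⟩
  have hs0 : 0 < s := Finset.sum_pos (fun q _ => pow_pos (h0 q) 2) hne
  have hs1 : s < 1 := by
    rw [hs, ← h1]
    exact Finset.sum_lt_sum_of_nonempty hne fun q _ => by nlinarith [h0 q, hlt q]
  have hlow : s ^ 2 ≤ u := by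
    have : 0 ≤ ∑ q, p q * (p q - s) ^ 2 :=
      Finset.sum_nonneg fun q _ => mul_nonneg (h0 q).le (sq_nonneg _)
    have he : ∀ c, ∑ q, p q * (p q - c) ^ 2 = u - 2 * c * s + c ^ 2 * 1 := by
      intro c
      rw [← h1, hu, hs, Finset.mul_sum, Finset.mul_sum, ← Finset.sum_sub_distrib,
        ← Finset.sum_add_distrib]
      exact Finset.sum_congr rfl fun q _ => by ring
    rw [he] at this
    nlinarith
  obtain ⟨x, hx0, hxs⟩ : ∃ x : ℝ, 0 < x ∧ x ^ 2 = s := ⟨√s, by positivity, Real.sq_sqrt hs0.le⟩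
  have hup : u ≤ x ^ 3 := by
    have hpx : ∀ q, p q ≤ x := by
      intro q
      have : p q ^ 2 ≤ s := Finset.single_le_sum (f := fun q => p q ^ 2)
        (fun k _ => sq_nonneg _) (Finset.mem_univ q)
      exact le_of_sq_le_sq (by rwa [hxs]) hx0.le
    calc u ≤ ∑ q, x * p q ^ 2 := Finset.sum_le_sum fun q _ => by
            nlinarith [hpx q, sq_nonneg (p q)]
      _ = x ^ 3 := by rw [← Finset.mul_sum, ← hs, ← hxs]; ring
  have hx1 : x < 1 := by nlinarith
  rw [← hxs] at hlow ⊢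
  -- The expression is affine in `u` with slope `1 - 3 s`; the sign of the slope decides which of `s
  -- ^ 2 ≤ u ≤ s ^ (3/2)` to insert.
  rcases le_total (3 * x ^ 2) 1 with h | h
  · have : 0 < x ^ 4 * (1 - x ^ 2) := mul_pos (by positivity) (by nlinarith)
    nlinarith [mul_le_mul_of_nonneg_left hlow (sub_nonneg.2 h)]
  · have : 0 < x ^ 3 * ((1 - x) ^ 2 * (1 + 2 * x)) :=
      mul_pos (by positivity) (mul_pos (pow_pos (by linarith) 2) (by positivity))
    nlinarith [mul_le_mul_of_nonneg_left hup (sub_nonneg.2 h)]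

/-! ### Mixed moments of the dyads -/

namespace PPSBM

/-- Bounded measurable functions of a trajectory. -/
structure IsTest {T : ℝ} (f : Path T → ℝ) : Prop where
  measurable : Measurable f
  bounded : ∃ C, ∀ N, ‖f N‖ ≤ C

namespace IsTest

variable {T : ℝ}

theorem const (c : ℝ) : IsTest (fun _ : Path T => c) := ⟨measurable_const, ‖c‖, fun _ => le_rfl⟩

theorem sub_const {f : Path T → ℝ} (hf : IsTest f) (c : ℝ) : IsTest fun N => f N - c := by
  obtain ⟨C, hC⟩ := hf.bounded
  exact ⟨hf.measurable.sub_const c, C + ‖c‖,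
    fun N => (norm_sub_le _ _).trans (by simpa using hC N)⟩

theorem pathPow (t : Icc (0 : ℝ) T) {c : ℝ} (h0 : 0 ≤ c) (h1 : c ≤ 1) : IsTest (pathPow t c) :=
  ⟨measurable_pathPow t c, 1, fun N => by
    simpa [PPSBM.pathPow, abs_of_nonneg h0] using pow_le_one₀ h0 h1⟩

theorem integrable {f : Path T → ℝ} (hf : IsTest f) (μ : Measure (Path T)) [IsFiniteMeasure μ] :
    Integrable f μ := by
  obtain ⟨C, hC⟩ := hf.bounded
  exact Integrable.of_bound hf.measurable.aestronglyMeasurable C (Filter.Eventually.of_forall hC)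

end IsTest

namespace AffiliationParam

variable {Q : ℕ} {T : ℝ}

/-- The mean of `f(N)` for a Poisson process with the intensity within groups. -/
noncomputable def meanIn (θ : AffiliationParam Q T) (f : Path T → ℝ) : ℝ :=
  ∫ N, f N ∂(poissonProcessLaw T θ.αin)

/-- The mean of `f(N)` for a Poisson process with the intensity between groups. -/
noncomputable def meanOut (θ : AffiliationParam Q T) (f : Path T → ℝ) : ℝ :=
  ∫ N, f N ∂(poissonProcessLaw T θ.αout)

/-- The `k`-th power sum of the group proportions. -/
def powerSum (θ : AffiliationParam Q T) (k : ℕ) : ℝ := ∑ q, θ.prop q ^ k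

theorem integral_prod_law (θ : AffiliationParam Q T) (hT : 0 < T) (n : ℕ)
    {f : Dyad n → Path T → ℝ} (hf : ∀ e, IsTest (f e)) :
    ∫ N, ∏ e, f e (N e) ∂(θ.law n)
      = ∑ z : Fin n → Fin Q, (∏ i, θ.prop (z i)) *
          ∏ e : Dyad n, if z e.1.1 = z e.1.2 then θ.meanIn (f e) else θ.meanOut (f e) := by
  have hP : ∀ q l, IsProbabilityMeasure (poissonProcessLaw T (θ.intensity q l)) := by
    intro q l
    refine isProbabilityMeasure_poissonProcessLaw hT ?_
    unfold intensity
    split_ifs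
    exacts [θ.αin_integrable, θ.αout_integrable]
  have hint : ∀ z : Fin n → Fin Q, Integrable (fun N : Dyad n → Path T => ∏ e, f e (N e))
      (conditionalLaw T θ.intensity z) := fun z =>
    Integrable.fintype_prod fun e => (hf e).integrable _
  rw [law, sbmLaw, integral_finsetSum_measure
    fun z _ => (hint z).smul_measure ENNReal.ofReal_ne_top]
  refine Finset.sum_congr rfl fun z _ => ?_
  rw [integral_smul_measure, ENNReal.toReal_ofReal
    (Finset.prod_nonneg fun i _ => (θ.prop_pos _).le), smul_eq_mul, conditionalLaw,
    integral_fintype_prod_eq_prod]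
  congr 1
  refine Finset.prod_congr rfl fun e _ => ?_
  unfold intensity
  split_ifs <;> rfl

theorem meanIn_const (θ : AffiliationParam Q T) (hT : 0 < T) (c : ℝ) :
    θ.meanIn (fun _ => c) = c := by
  have := isProbabilityMeasure_poissonProcessLaw hT θ.αin_integrable
  simp [meanIn]

theorem meanOut_const (θ : AffiliationParam Q T) (hT : 0 < T) (c : ℝ) :
    θ.meanOut (fun _ => c) = c := by
  have := isProbabilityMeasure_poissonProcessLaw hT θ.αout_integrable
  simp [meanOut]

theorem meanIn_sub_const (θ : AffiliationParam Q T) (hT : 0 < T) {f : Path T → ℝ}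
    (hf : IsTest f) (c : ℝ) : θ.meanIn (fun N => f N - c) = θ.meanIn f - c := by
  have := isProbabilityMeasure_poissonProcessLaw hT θ.αin_integrable
  simp [meanIn, integral_sub (hf.integrable _) (integrable_const c)]

theorem meanOut_sub_const (θ : AffiliationParam Q T) (hT : 0 < T) {f : Path T → ℝ}
    (hf : IsTest f) (c : ℝ) : θ.meanOut (fun N => f N - c) = θ.meanOut f - c := by
  have := isProbabilityMeasure_poissonProcessLaw hT θ.αout_integrable
  simp [meanOut, integral_sub (hf.integrable _) (integrable_const c)]

/-- A test function that detects the intensities only within groups recovers the power sums of the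
group proportions. -/
theorem integral_prod_clique (θ : AffiliationParam Q T) (hT : 0 < T) {n : ℕ} (S : Finset (Fin n))
    (hS : S.Nonempty) {f : Path T → ℝ} (hf : IsTest f) (h0 : θ.meanOut f = 0) :
    ∫ N : Dyad n → Path T, ∏ e, (if e.1.1 ∈ S ∧ e.1.2 ∈ S then f else fun _ => 1) (N e) ∂(θ.law n)
      = θ.meanIn f ^ (Finset.univ.filter fun e : Dyad n => e.1.1 ∈ S ∧ e.1.2 ∈ S).card *
        θ.powerSum S.card := by
  classical
  rw [θ.integral_prod_law hT n
    (f := fun e => if e.1.1 ∈ S ∧ e.1.2 ∈ S then f else fun _ => 1)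
    (fun e => by split_ifs; exacts [hf, IsTest.const 1]), powerSum,
    ← sum_prod_ite_const_on_eq_sum_pow θ.prop θ.sum_prop S hS, Finset.mul_sum]
  refine Finset.sum_congr rfl fun z _ => ?_
  rw [mul_left_comm]
  congr 1
  have : ∀ e : Dyad n, (if z e.1.1 = z e.1.2
        then θ.meanIn (if e.1.1 ∈ S ∧ e.1.2 ∈ S then f else fun _ => 1)
        else θ.meanOut (if e.1.1 ∈ S ∧ e.1.2 ∈ S then f else fun _ => 1))
      = if e.1.1 ∈ S ∧ e.1.2 ∈ S then (if z e.1.1 = z e.1.2 then θ.meanIn f else 0) else 1 := by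
    intro e
    split_ifs <;> simp [h0, meanIn_const, meanOut_const, hT]
  simp_rw [this]
  rw [← Finset.prod_filter, Finset.prod_ite_zero, Finset.prod_const, mul_ite, mul_one, mul_zero]
  congr 1
  refine propext ⟨fun h i hi j hj => ?_, fun h e he => ?_⟩
  · rcases lt_trichotomy i j with hij | hij | hij
    · exact h ⟨(i, j), hij⟩ (by simp [hi, hj])
    · rw [hij]
    · exact (h ⟨(j, i), hij⟩ (by simp [hi, hj])).symm
  · rw [Finset.mem_filter] at he
    exact h _ he.2.1 _ he.2.2

/-- The test functions `f`, `g`, `h` on the dyads of the triangle formed by the individuals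
`i < j < k`, and `1` elsewhere. -/
noncomputable def triangle {n : ℕ} {i j k : Fin n} (hij : i < j) (hjk : j < k) (f g h : Path T → ℝ)
    (e : Dyad n) : Path T → ℝ :=
  if e = ⟨(i, j), hij⟩ then f
  else if e = ⟨(i, k), hij.trans hjk⟩ then g
  else if e = ⟨(j, k), hjk⟩ then h
  else fun _ => 1

theorem isTest_triangle {n : ℕ} {i j k : Fin n} (hij : i < j) (hjk : j < k) {f g h : Path T → ℝ}
    (hf : IsTest f) (hg : IsTest g) (hh : IsTest h) (e : Dyad n) :
    IsTest (triangle hij hjk f g h e) := by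
  unfold triangle
  split_ifs
  exacts [hf, hg, hh, IsTest.const 1]

/-- Each edge contributes `meanOut + D * 1{same group}`. One indicator has mean `p_2`; by
transitivity, two of them already imply the third, so pairs and the triple all have mean `p_3`. -/
theorem integral_triangle (θ : AffiliationParam Q T) (hT : 0 < T) {n : ℕ} {i j k : Fin n}
    (hij : i < j) (hjk : j < k) {f g h : Path T → ℝ}
    (hf : IsTest f) (hg : IsTest g) (hh : IsTest h) :
    ∫ N, ∏ e, triangle hij hjk f g h e (N e) ∂(θ.law n)
      = θ.meanOut f * θ.meanOut g * θ.meanOut h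
        + θ.powerSum 2 * ((θ.meanIn f - θ.meanOut f) * θ.meanOut g * θ.meanOut h
          + θ.meanOut f * (θ.meanIn g - θ.meanOut g) * θ.meanOut h
          + θ.meanOut f * θ.meanOut g * (θ.meanIn h - θ.meanOut h))
        + θ.powerSum 3 * ((θ.meanIn f - θ.meanOut f) * (θ.meanIn g - θ.meanOut g) * θ.meanOut h
          + (θ.meanIn f - θ.meanOut f) * θ.meanOut g * (θ.meanIn h - θ.meanOut h)
          + θ.meanOut f * (θ.meanIn g - θ.meanOut g) * (θ.meanIn h - θ.meanOut h)
          + (θ.meanIn f - θ.meanOut f) * (θ.meanIn g - θ.meanOut g)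
            * (θ.meanIn h - θ.meanOut h)) := by
  classical
  rw [θ.integral_prod_law hT _ (isTest_triangle hij hjk hf hg hh)]
  have hprod : ∀ z : Fin n → Fin Q,
      (∏ e : Dyad n, if z e.1.1 = z e.1.2 then θ.meanIn (triangle hij hjk f g h e)
        else θ.meanOut (triangle hij hjk f g h e))
      = (if z i = z j then θ.meanIn f else θ.meanOut f)
        * (if z i = z k then θ.meanIn g else θ.meanOut g)
        * (if z j = z k then θ.meanIn h else θ.meanOut h) := by
    intro z
    rw [← Finset.prod_subset (Finset.subset_univ
      ({⟨(i, j), hij⟩, ⟨(i, k), hij.trans hjk⟩, ⟨(j, k), hjk⟩} : Finset (Dyad n)))]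
    · rw [Finset.prod_insert, Finset.prod_insert, Finset.prod_singleton]
      · simp [triangle, hij.ne', hjk.ne', mul_assoc]
      · simp [hij.ne]
      · simp [hij.ne, hjk.ne]
    · intro e _ he
      simp only [Finset.mem_insert, Finset.mem_singleton, not_or] at he
      simp [triangle, he, meanIn_const, meanOut_const, hT]
  have hsum : ∀ S : Finset (Fin n), S.Nonempty →
      ∑ z : Fin n → Fin Q, (∏ i, θ.prop (z i)) *
        (if ∀ i ∈ S, ∀ j ∈ S, z i = z j then 1 else 0) = θ.powerSum S.card :=
    fun S hS => sum_prod_ite_const_on_eq_sum_pow θ.prop θ.sum_prop S hS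
  have e0 := hsum {i} (by simp)
  have e01 := hsum {i, j} (by simp)
  have e02 := hsum {i, k} (by simp)
  have e12 := hsum {j, k} (by simp)
  have e012 := hsum {i, j, k} (by simp)
  rw [Finset.card_singleton] at e0
  rw [Finset.card_pair hij.ne] at e01
  rw [Finset.card_pair (hij.trans hjk).ne] at e02
  rw [Finset.card_pair hjk.ne] at e12
  rw [Finset.card_eq_three.2 ⟨i, j, k, hij.ne, (hij.trans hjk).ne, hjk.ne, rfl⟩] at e012
  have e1 : θ.powerSum 1 = 1 := by simp [powerSum, θ.sum_prop]
  rw [e1] at e0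
  simp_rw [hprod]
  rw [← mul_one (θ.meanOut f * θ.meanOut g * θ.meanOut h), ← e0, mul_add (θ.powerSum 2),
    mul_add (θ.powerSum 2)]
  -- The three occurrences of `powerSum 2` must be expanded over three different pairs, in order.
  nth_rewrite 1 [← e01]
  nth_rewrite 1 [← e02]
  rw [← e12, ← e012]
  simp only [Finset.mul_sum, Finset.sum_mul, ← Finset.sum_add_distrib]
  refine Finset.sum_congr rfl fun z _ => ?_
  simp only [Finset.mem_insert, Finset.mem_singleton, forall_eq_or_imp, forall_eq]
  generalize z i = x, z j = y, z k = w
  rcases eq_or_ne x y with rfl | a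
  · rcases eq_or_ne x w with rfl | b
    · simp
      ring
    · simp [b, b.symm]
      ring
  · rcases eq_or_ne x w with rfl | b
    · simp [a, a.symm]
      ring
    · rcases eq_or_ne y w with rfl | c
      · simp [a, a.symm]
        ring
      · simp [a, b, c]
        ring

end AffiliationParam
end PPSBM

/-! ### Cumulants and identification -/

namespace PPSBM

namespace AffiliationParam

variable {Q : ℕ} {T : ℝ}

/-- The mean of one dyad. -/
theorem integral_edge (θ : AffiliationParam Q T) (hT : 0 < T) {n : ℕ} {i j k : Fin n}
    (hij : i < j) (hjk : j < k) {f : Path T → ℝ} (hf : IsTest f) :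
    ∫ N, ∏ e, triangle hij hjk f (fun _ => 1) (fun _ => 1) e (N e) ∂(θ.law n)
      = θ.meanOut f + θ.powerSum 2 * (θ.meanIn f - θ.meanOut f) := by
  rw [θ.integral_triangle hT hij hjk hf (IsTest.const 1) (IsTest.const 1)]
  simp only [meanIn_const, meanOut_const, hT]
  ring

/-- The coefficient of the third joint cumulant of the three edges of a triangle. -/
def cumulantCoeff (θ : AffiliationParam Q T) : ℝ :=
  θ.powerSum 3 - 3 * θ.powerSum 2 * θ.powerSum 3 + 2 * θ.powerSum 2 ^ 3

/-- The third joint cumulant of test functions on the three edges of a triangle. -/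
theorem cumulant_triangle (θ : AffiliationParam Q T) (hT : 0 < T) {n : ℕ} {i j k : Fin n}
    (hij : i < j) (hjk : j < k) {f g h : Path T → ℝ}
    (hf : IsTest f) (hg : IsTest g) (hh : IsTest h) :
    θ.cumulantCoeff * ((θ.meanIn f - θ.meanOut f) * (θ.meanIn g - θ.meanOut g)
        * (θ.meanIn h - θ.meanOut h))
      = let J := fun f g h => ∫ N, ∏ e, triangle hij hjk f g h e (N e) ∂(θ.law n)
        let o := fun _ => 1
        J f g h - J f g o * J o o h - J f o h * J o g o - J o g h * J f o o
          + 2 * J f o o * J o g o * J o o h := by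
  have ho : IsTest (fun _ : Path T => (1 : ℝ)) := IsTest.const 1
  simp only [θ.integral_triangle hT hij hjk, meanIn_const, meanOut_const, hf, hg, hh, ho, hT,
    cumulantCoeff]
  ring

theorem meanIn_pathPow (θ : AffiliationParam Q T) (t : Icc (0 : ℝ) T) {c : ℝ} (h0 : 0 ≤ c) :
    θ.meanIn (pathPow t c)
      = Real.exp (-((1 - c) * (intensityMeasure T θ.αin).real (Iic (t : ℝ)))) :=
  integral_pathPow θ.αin_integrable t h0

theorem meanOut_pathPow (θ : AffiliationParam Q T) (t : Icc (0 : ℝ) T) {c : ℝ} (h0 : 0 ≤ c) :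
    θ.meanOut (pathPow t c)
      = Real.exp (-((1 - c) * (intensityMeasure T θ.αout).real (Iic (t : ℝ)))) :=
  integral_pathPow θ.αout_integrable t h0

/-- The generating function at `1/2` already determines the cumulative intensity at `t`. -/
theorem exists_meanIn_ne_meanOut (θ : AffiliationParam Q T) (hT : 0 < T)
    (h : ¬ θ.αin =ᵐ[volume.restrict (Icc (0 : ℝ) T)] θ.αout) :
    ∃ t : Icc (0 : ℝ) T, θ.meanIn (pathPow t (1 / 2)) ≠ θ.meanOut (pathPow t (1 / 2)) := by
  by_contra! hall
  refine h (ae_eq_of_intensityMeasure_Iic_eq hT θ.αin_integrable θ.αout_integrable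
    θ.αin_nonneg θ.αout_nonneg fun t ht => ?_)
  have := hall ⟨t, ht⟩
  rw [meanIn_pathPow _ _ (by norm_num), meanOut_pathPow _ _ (by norm_num), Real.exp_eq_exp] at this
  simp only at this
  linarith

end AffiliationParam

/-- A Poisson distribution that is an affine combination of two distinct Poisson distributions is
one of these two. -/
theorem affine_exp_eq_zero_or_one {a b c l : ℝ} (hab : Real.exp (-((1 - 1 / 2) * a))
      ≠ Real.exp (-((1 - 1 / 2) * b)))
    (h1 : Real.exp (-((1 - 1 / 2) * c)) = Real.exp (-((1 - 1 / 2) * b))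
      + l * (Real.exp (-((1 - 1 / 2) * a)) - Real.exp (-((1 - 1 / 2) * b))))
    (h2 : Real.exp (-((1 - 0) * c)) = Real.exp (-((1 - 0) * b))
      + l * (Real.exp (-((1 - 0) * a)) - Real.exp (-((1 - 0) * b)))) :
    l = 0 ∨ l = 1 := by
  -- The generating function at `0` is the square of that at `1/2`, so `(v + l (u - v)) ^ 2 = v ^ 2
  -- + l (u ^ 2 - v ^ 2)`.
  have hsq : ∀ x : ℝ, Real.exp (-((1 - 0) * x)) = Real.exp (-((1 - 1 / 2) * x)) ^ 2 := by
    intro x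
    rw [← Real.exp_nat_mul]
    congr 1
    push_cast
    ring
  rw [hsq, hsq, hsq, h1] at h2
  have : l * (l - 1) * (Real.exp (-((1 - 1 / 2) * a)) - Real.exp (-((1 - 1 / 2) * b))) ^ 2 = 0 := by
    linear_combination h2
  rcases mul_eq_zero.1 this with h | h
  · rcases mul_eq_zero.1 h with h | h
    · exact Or.inl h
    · exact Or.inr (sub_eq_zero.1 h)
  · exact absurd (sub_eq_zero.1 (pow_eq_zero_iff two_ne_zero |>.1 h)) hab

namespace AffiliationParam

variable {Q : ℕ} {T : ℝ}

/-- The law of a triangle determines the two Poisson process laws. -/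
theorem mean_eq_of_law_eq {n : ℕ} (hT : 0 < T) (hQ : 2 ≤ Q) (hn : 3 ≤ n)
    (θ θ' : AffiliationParam Q T) (hlaw : θ.law n = θ'.law n) {t : Icc (0 : ℝ) T}
    (ht : θ.meanIn (pathPow t (1 / 2)) ≠ θ.meanOut (pathPow t (1 / 2)))
    {f : Path T → ℝ} (hf : IsTest f) :
    θ'.meanIn f = θ.meanIn f ∧ θ'.meanOut f = θ.meanOut f := by
  have hij : (⟨0, by omega⟩ : Fin n) < ⟨1, by omega⟩ := by simp
  have hjk : (⟨1, by omega⟩ : Fin n) < ⟨2, by omega⟩ := by simp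
  have hedge : ∀ {f : Path T → ℝ}, IsTest f →
      θ'.meanOut f + θ'.powerSum 2 * (θ'.meanIn f - θ'.meanOut f)
        = θ.meanOut f + θ.powerSum 2 * (θ.meanIn f - θ.meanOut f) := by
    intro f hf
    rw [← θ.integral_edge hT hij hjk hf, ← θ'.integral_edge hT hij hjk hf, hlaw]
  have hcum : ∀ {f g h : Path T → ℝ}, IsTest f → IsTest g → IsTest h →
      θ'.cumulantCoeff * ((θ'.meanIn f - θ'.meanOut f) * (θ'.meanIn g - θ'.meanOut g)
        * (θ'.meanIn h - θ'.meanOut h))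
      = θ.cumulantCoeff * ((θ.meanIn f - θ.meanOut f) * (θ.meanIn g - θ.meanOut g)
        * (θ.meanIn h - θ.meanOut h)) := by
    intro f g h hf hg hh
    rw [θ.cumulant_triangle hT hij hjk hf hg hh, θ'.cumulant_triangle hT hij hjk hf hg hh, hlaw]
  have hκ : 0 < θ.cumulantCoeff := triangle_cumulant_pos hQ θ.prop θ.prop_pos θ.sum_prop
  have hκ' : 0 < θ'.cumulantCoeff := triangle_cumulant_pos hQ θ'.prop θ'.prop_pos θ'.sum_prop
  have ht1 : IsTest (pathPow t (1 / 2)) := IsTest.pathPow t (by norm_num) (by norm_num)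
  -- Since `0 ^ 0 = 1`, this is the indicator of no event up to `t`.
  have ht0 : IsTest (pathPow t 0) := IsTest.pathPow t le_rfl zero_le_one
  set D := θ.meanIn (pathPow t (1 / 2)) - θ.meanOut (pathPow t (1 / 2)) with hD
  set D' := θ'.meanIn (pathPow t (1 / 2)) - θ'.meanOut (pathPow t (1 / 2)) with hD'
  have hD0 : D ≠ 0 := sub_ne_zero.2 ht
  have hD0' : D' ≠ 0 := by
    intro h0
    have := hcum ht1 ht1 ht1
    rw [← hD, ← hD', h0] at this
    have hne : θ.cumulantCoeff * (D * D * D) ≠ 0 := by positivity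
    exact hne (by rw [← this]; ring)
  obtain ⟨c, hc0, hc⟩ : ∃ c : ℝ, 0 < c ∧ ∀ {f : Path T → ℝ}, IsTest f →
      θ'.meanIn f - θ'.meanOut f = c * (θ.meanIn f - θ.meanOut f) := by
    -- The cumulant with `f` on one edge and the fixed test on the other two: `D` and `D'` enter
    -- squared, whence `c > 0`.
    refine ⟨θ.cumulantCoeff * D ^ 2 / (θ'.cumulantCoeff * D' ^ 2), by positivity, ?_⟩
    intro f hf
    have := hcum hf ht1 ht1
    rw [← hD, ← hD'] at this
    field_simp
    linear_combination this
  have hout : ∀ {f : Path T → ℝ}, IsTest f → θ'.meanOut f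
      = θ.meanOut f + (θ.powerSum 2 - θ'.powerSum 2 * c) * (θ.meanIn f - θ.meanOut f) := by
    intro f hf
    linear_combination hedge hf - θ'.powerSum 2 * hc hf
  have hin : ∀ {f : Path T → ℝ}, IsTest f → θ'.meanIn f
      = θ.meanOut f + (θ.powerSum 2 - θ'.powerSum 2 * c + c) * (θ.meanIn f - θ.meanOut f) := by
    intro f hf
    linear_combination hc hf + hout hf
  have hout1 := hout ht1
  have hout0 := hout ht0
  have hin1 := hin ht1
  have hin0 := hin ht0
  have hhalf : (0 : ℝ) ≤ 1 / 2 := by norm_num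
  simp only [meanIn_pathPow _ _ hhalf, meanOut_pathPow _ _ hhalf, meanIn_pathPow _ _ le_rfl,
    meanOut_pathPow _ _ le_rfl] at hout1 hout0 hin1 hin0 ht
  have hl := affine_exp_eq_zero_or_one ht hout1 hout0
  have hm := affine_exp_eq_zero_or_one ht hin1 hin0
  -- The two coefficients lie in `{0, 1}` and differ by `c > 0`.
  have hl0 : θ.powerSum 2 - θ'.powerSum 2 * c = 0 := by
    rcases hl with h | h
    · exact h
    · rcases hm with h' | h' <;> linarith
  have hm1 : θ.powerSum 2 - θ'.powerSum 2 * c + c = 1 := by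
    rcases hm with h' | h'
    · linarith
    · exact h'
  rw [hin hf, hout hf, hm1, hl0]
  constructor <;> ring

/-- The centred test has `meanOut` zero under both parameters and the same nonzero `meanIn`, whose
power cancels. -/
theorem powerSum_eq_of_law_eq {n : ℕ} (hT : 0 < T) (hQ : 2 ≤ Q) (hn : 3 ≤ n)
    (θ θ' : AffiliationParam Q T) (hlaw : θ.law n = θ'.law n) {t : Icc (0 : ℝ) T}
    (ht : θ.meanIn (pathPow t (1 / 2)) ≠ θ.meanOut (pathPow t (1 / 2)))
    {k : ℕ} (hk : 1 ≤ k) (hkn : k ≤ n) : θ.powerSum k = θ'.powerSum k := by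
  have ht1 : IsTest (pathPow t (1 / 2)) := IsTest.pathPow t (by norm_num) (by norm_num)
  obtain ⟨S, -, rfl⟩ := Finset.exists_subset_card_eq (s := (Finset.univ : Finset (Fin n)))
    (by simpa using hkn)
  have hf := ht1.sub_const (θ.meanOut (pathPow t (1 / 2)))
  obtain ⟨h1, h2⟩ := mean_eq_of_law_eq hT hQ hn θ θ' hlaw ht hf
  have hS := Finset.card_pos.1 hk
  have h0 : θ.meanOut (fun N => pathPow t (1 / 2) N - θ.meanOut (pathPow t (1 / 2))) = 0 := by
    rw [θ.meanOut_sub_const hT ht1, sub_self]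
  have e := θ.integral_prod_clique hT S hS hf h0
  rw [hlaw, θ'.integral_prod_clique hT S hS hf (h2.trans h0), h1,
    θ.meanIn_sub_const hT ht1] at e
  exact (mul_left_cancel₀ (pow_ne_zero _ (sub_ne_zero.2 ht)) e).symm

end AffiliationParam
end PPSBM

theorem proposition2 (n Q : ℕ) (T : ℝ) (hT : 0 < T) (hQ : 2 ≤ Q) (hn : 3 ≤ n)
    (θ θ' : PPSBM.AffiliationParam Q T)
    (hdistinct : ¬ θ.αin =ᵐ[volume.restrict (Icc (0 : ℝ) T)] θ.αout)
    (hlaw : θ.law n = θ'.law n) :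
    (θ.αin =ᵐ[volume.restrict (Icc (0 : ℝ) T)] θ'.αin ∧
      θ.αout =ᵐ[volume.restrict (Icc (0 : ℝ) T)] θ'.αout) ∧
    (Q ≤ n → ∃ σ : Equiv.Perm (Fin Q), ∀ q, θ.prop q = θ'.prop (σ q)) := by
  obtain ⟨t₀, ht₀⟩ := θ.exists_meanIn_ne_meanOut hT hdistinct
  have hhalf : (0 : ℝ) ≤ 1 / 2 := by norm_num
  have hmean : ∀ t : Icc (0 : ℝ) T, _ := fun t =>
    PPSBM.AffiliationParam.mean_eq_of_law_eq hT hQ hn θ θ' hlaw ht₀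
      (PPSBM.IsTest.pathPow t hhalf (by norm_num))
  refine ⟨⟨?_, ?_⟩, fun hQn => exists_perm_of_sum_pow_eq _ _ fun k hk hkQ =>
    PPSBM.AffiliationParam.powerSum_eq_of_law_eq hT hQ hn θ θ' hlaw ht₀ hk (hkQ.trans hQn)⟩
  · refine PPSBM.ae_eq_of_intensityMeasure_Iic_eq hT θ.αin_integrable θ'.αin_integrable
      θ.αin_nonneg θ'.αin_nonneg fun t ht => ?_
    have := (hmean ⟨t, ht⟩).1
    rw [θ.meanIn_pathPow _ hhalf, θ'.meanIn_pathPow _ hhalf, Real.exp_eq_exp] at this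
    linarith
  · refine PPSBM.ae_eq_of_intensityMeasure_Iic_eq hT θ.αout_integrable θ'.αout_integrable
      θ.αout_nonneg θ'.αout_nonneg fun t ht => ?_
    have := (hmean ⟨t, ht⟩).2
    rw [θ.meanOut_pathPow _ hhalf, θ'.meanOut_pathPow _ hhalf, Real.exp_eq_exp] at this
    linarith
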